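/- Let $M$ be a smooth supermanifold of dimension $n|m$ with an odd Poisson (Schouten) structure, i.e., an odd fibrewise quadratic function $\mathfrak S=\tfrac12\mathfrak S^{ab}(x)p_bp_a$ on $T^*M$ whose odd bracket $$\{f,g\}=-(-1)^{\tilde f(\tilde a+1)}\mathfrak S^{ab}\,\frac{\partial f}{\partial x^b}\frac{\partial g}{\partial x^a}$$ satisfies the Jacobi identity. (A tilde denotes parity.) For a function $f$ let $X_f=(-1)^{\tilde f+1}\{f,\ \cdot\ \}$ be its Hamiltonian vector field. For a non-degenerate even volume form $\boldsymbol\rho=\rho(x)\,Dx$ (a basis element of the module of sections of the Berezinian of $M$) let $$\Delta_{\boldsymbol\rho}f=\operatorname{div}_{\boldsymbol\rho}X_f=\frac{L_{X_f}\boldsymbol\rho}{\boldsymbol\rho},\qquad \operatorname{div}_{\boldsymbol\rho}X=\frac1\rho\,(-1)^{\tilde a(\tilde X+1)}\frac{\partial(\rho X^a)}{\partial x^a},$$ be the odd Laplace operator on functions. **Theorem.** The solutions of the equations $\Delta_{\boldsymbol\rho}e^{\sigma/2}=0$ form a groupoid (the "master groupoid"): its objects are the non-degenerate even volume forms on $M$;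 its arrows $\boldsymbol\rho\to\boldsymbol\rho'$ are the even functions $\sigma$ on $M$ such that $\boldsymbol\rho'=e^{\sigma}\boldsymbol\rho$ and $\Delta_{\boldsymbol\rho}e^{\sigma/2}=0$; identities, composition and inverses are given by $0$, $\sigma+\tau$ and $-\sigma$ (that is, by multiplication of the factors $e^\sigma$). Explicitly, let $\boldsymbol\rho,\boldsymbol\rho',\boldsymbol\rho''$ be non-degenerate even volume forms and $\sigma,\tau$ even functions with $\boldsymbol\rho'=e^{\sigma}\boldsymbol\rho$ and $\boldsymbol\rho''=e^{\tau}\boldsymbol\rho'$. 1. If $\Delta_{\boldsymbol\rho}e^{\sigma/2}=0$ and $\Delta_{\boldsymbol\rho'}e^{\tau/2}=0$, then $\Delta_{\boldsymbol\rho}e^{(\sigma+\tau)/2}=0$. 2. If $\Delta_{\boldsymbol\rho}e^{\sigma/2}=0$, then $\Delta_{\boldsymbol\rho'}e^{-\sigma/2}=0$. -/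

import Mathlib

open scoped ContDiff TensorProduct

universe u

noncomputable section

namespace OddPoisson

/-! ### Parities, signs and indices -/

/-- The sign `(-1)^p` of a parity `p`, as a real scalar. -/
def sgn (p : ZMod 2) : ℝ := if p = 0 then 1 else -1

/-- Indices of `n` even and `m` odd coordinates. -/
abbrev Idx (n m : ℕ) : Type := Fin n ⊕ Fin m

/-- Parity of the coordinate with a given index. -/
def par {n m : ℕ} : Idx n m → ZMod 2 := Sum.elim (fun _ => 0) (fun _ => 1)

/-! ### The local model: `C^∞(V) ⊗ Λ(ξ₁, …, ξₘ)` for `V` open in `ℝⁿ` -/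

/-- Extension by zero of a function on an open set. -/
def ext0 {n : ℕ} {V : TopologicalSpace.Opens (Fin n → ℝ)} (f : V → ℝ) : (Fin n → ℝ) → ℝ :=
  Function.extend Subtype.val f 0

theorem ext0_apply {n : ℕ} {V : TopologicalSpace.Opens (Fin n → ℝ)} (f : V → ℝ)
    {x : Fin n → ℝ} (hx : x ∈ V) : ext0 f x = f ⟨x, hx⟩ :=
  Subtype.val_injective.extend_apply f 0 ⟨x, hx⟩

/-- A function on `V` is smooth iff it agrees on `V` with a function that is smooth on `V`. -/
theorem contDiffOn_ext0 {n : ℕ} {V : TopologicalSpace.Opens (Fin n → ℝ)} {f : V → ℝ}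
    {g : (Fin n → ℝ) → ℝ} (hg : ContDiffOn ℝ ∞ g V) (h : ∀ x : V, f x = g x) :
    ContDiffOn ℝ ∞ (ext0 f) V :=
  hg.congr fun x hx => by rw [ext0_apply f hx]; exact h ⟨x, hx⟩

/-- The algebra `C^∞(V)` of smooth real functions on an open set `V ⊆ ℝⁿ`. -/
def Smooth {n : ℕ} (V : TopologicalSpace.Opens (Fin n → ℝ)) : Subalgebra ℝ (V → ℝ) where
  carrier := {f | ContDiffOn ℝ ∞ (ext0 f) V}
  mul_mem' {f g} hf hg := contDiffOn_ext0 (ContDiffOn.mul hf hg) fun x => by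
    simp [ext0_apply _ x.2]
  add_mem' {f g} hf hg := contDiffOn_ext0 (ContDiffOn.add hf hg) fun x => by
    simp [ext0_apply _ x.2]
  algebraMap_mem' r := contDiffOn_ext0 (g := fun _ => r) contDiffOn_const fun _ => rfl

/-- Restriction of smooth functions to a smaller open set. -/
def Smooth.res {n : ℕ} {V W : TopologicalSpace.Opens (Fin n → ℝ)} (h : W ≤ V) :
    Smooth V →ₐ[ℝ] Smooth W where
  toFun f := ⟨fun x => f.1 ⟨x, h x.2⟩,
    contDiffOn_ext0 (ContDiffOn.mono f.2 h) fun x => (ext0_apply f.1 (h x.2)).symm⟩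
  map_one' := rfl
  map_mul' _ _ := rfl
  map_zero' := rfl
  map_add' _ _ := rfl
  commutes' _ := rfl

/-- The `i`-th coordinate as a smooth function. -/
def Smooth.coord {n : ℕ} (V : TopologicalSpace.Opens (Fin n → ℝ)) (i : Fin n) : Smooth V :=
  ⟨fun x => x.1 i, contDiffOn_ext0 (g := fun x => x i) (by fun_prop) fun _ => rfl⟩

/-- The exponential of a smooth function. -/
def Smooth.exp {n : ℕ} {V : TopologicalSpace.Opens (Fin n → ℝ)} (f : Smooth V) : Smooth V :=
  ⟨fun x => Real.exp (f.1 x), contDiffOn_ext0 (ContDiffOn.exp f.2) fun x => by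
    simp [ext0_apply _ x.2]⟩

/-- The partial derivative `∂/∂xⁱ` on smooth functions. -/
def Smooth.pd {n : ℕ} (V : TopologicalSpace.Opens (Fin n → ℝ)) (i : Fin n) :
    Smooth V →ₗ[ℝ] Smooth V where
  toFun f := ⟨fun x => fderiv ℝ (ext0 f.1) x.1 (Pi.single i 1), by
    have h : ContDiffOn ℝ ∞ (fderiv ℝ (ext0 f.1)) V :=
      ContDiffOn.fderiv_of_isOpen f.2 V.2 (by simp)
    exact contDiffOn_ext0 (h.clm_apply contDiffOn_const) fun _ => rfl⟩
  map_add' f g := by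
    ext x
    have key : ∀ k : Smooth V, DifferentiableAt ℝ (ext0 k.1) x.1 := fun k =>
      (ContDiffOn.contDiffAt k.2 (V.2.mem_nhds x.2)).differentiableAt (by simp)
    have e : ext0 (f + g).1 = ext0 f.1 + ext0 g.1 := by
      funext y
      by_cases hy : y ∈ V
      · simp [ext0_apply _ hy]
      · have hn : ¬ ∃ a : V, (a : Fin n → ℝ) = y := fun ⟨a, ha⟩ => hy (ha ▸ a.2)
        simp [ext0, Function.extend_apply' _ _ _ hn]
    change fderiv ℝ (ext0 (f + g).1) x.1 _ = fderiv ℝ (ext0 f.1) x.1 _ + fderiv ℝ (ext0 g.1) x.1 _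
    rw [e, fderiv_add (key f) (key g)]
    rfl
  map_smul' c f := by
    ext x
    have key : DifferentiableAt ℝ (ext0 f.1) x.1 :=
      (ContDiffOn.contDiffAt f.2 (V.2.mem_nhds x.2)).differentiableAt (by simp)
    have e : ext0 (c • f).1 = c • ext0 f.1 := by
      funext y
      by_cases hy : y ∈ V
      · simp [ext0_apply _ hy]
      · have hn : ¬ ∃ a : V, (a : Fin n → ℝ) = y := fun ⟨a, ha⟩ => hy (ha ▸ a.2)
        simp [ext0, Function.extend_apply' _ _ _ hn]
    change fderiv ℝ (ext0 (c • f).1) x.1 _ = c • fderiv ℝ (ext0 f.1) x.1 _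
    rw [e, fderiv_const_smul key]
    rfl

/-- The Grassmann algebra `Λ(ξ₁, …, ξₘ)`. -/
abbrev Grassmann (m : ℕ) : Type := ExteriorAlgebra ℝ (Fin m → ℝ)

/-- The algebra of functions on the superdomain `V^{n|m}`. -/
abbrev Model {n : ℕ} (m : ℕ) (V : TopologicalSpace.Opens (Fin n → ℝ)) : Type :=
  Smooth V ⊗[ℝ] Grassmann m

namespace Model

variable {n : ℕ} (m : ℕ)

/-- Restriction to a smaller open set. -/
def res {V W : TopologicalSpace.Opens (Fin n → ℝ)} (h : W ≤ V) : Model m V →ₐ[ℝ] Model m W :=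
  Algebra.TensorProduct.map (Smooth.res h) (AlgHom.id ℝ (Grassmann m))

/-- The even (`p = 0`) and odd (`p = 1`) functions on a superdomain. -/
def part (V : TopologicalSpace.Opens (Fin n → ℝ)) (p : ZMod 2) : Submodule ℝ (Model m V) :=
  LinearMap.range (LinearMap.lTensor (Smooth V)
    (CliffordAlgebra.evenOdd (0 : QuadraticForm ℝ (Fin m → ℝ)) p).subtype)

/-- The standard coordinates `x¹, …, xⁿ, ξ₁, …, ξₘ`. -/
def coord (V : TopologicalSpace.Opens (Fin n → ℝ)) : Idx n m → Model m V
  | Sum.inl i => Smooth.coord V i ⊗ₜ 1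
  | Sum.inr j => 1 ⊗ₜ ExteriorAlgebra.ι ℝ (Pi.single j 1)

/-- The (left) partial derivatives `∂/∂xⁱ`, `∂/∂ξⱼ`. -/
def pd (V : TopologicalSpace.Opens (Fin n → ℝ)) : Idx n m → (Model m V →ₗ[ℝ] Model m V)
  | Sum.inl i => LinearMap.rTensor (Grassmann m) (Smooth.pd V i)
  | Sum.inr j => LinearMap.lTensor (Smooth V)
      (CliffordAlgebra.contractLeft (Q := (0 : QuadraticForm ℝ (Fin m → ℝ)))
        (LinearMap.proj j : (Fin m → ℝ) →ₗ[ℝ] ℝ))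

/-- The value of a function at `ξ = 0`. -/
def body (V : TopologicalSpace.Opens (Fin n → ℝ)) : Model m V →ₐ[ℝ] Smooth V :=
  (Algebra.TensorProduct.rid ℝ ℝ (Smooth V)).toAlgHom.comp
    (Algebra.TensorProduct.map (AlgHom.id ℝ (Smooth V)) ExteriorAlgebra.algebraMapInv)

/-- The exponential `e^f = e^{f₀} ∑ₖ νᵏ/k!` of an even function `f = f₀ + ν`, where `f₀` is the
body of `f` and `ν` is nilpotent with `ν^{m+1} = 0`. -/
def exp {V : TopologicalSpace.Opens (Fin n → ℝ)} (f : Model m V) : Model m V :=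
  (Smooth.exp (body m V f) ⊗ₜ 1) *
    ∑ k ∈ Finset.range (m + 1), ((k.factorial : ℝ)⁻¹) • (f - body m V f ⊗ₜ 1) ^ k

end Model

/-! ### The Berezinian -/

/-- The Leibniz formula for the determinant, for matrices with (commuting) entries in a ring that
need not be commutative. -/
def leibnizDet {k : ℕ} {R : Type*} [Ring R] (A : Matrix (Fin k) (Fin k) R) : R :=
  ∑ s : Equiv.Perm (Fin k), ((Equiv.Perm.sign s : ℤˣ) : ℤ) • (List.ofFn fun i => A (s i) i).prod

/-- The Berezinian `det (A - B D⁻¹ C) (det D)⁻¹` of an even invertible matrix with blocks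
`A`, `B`, `C`, `D`. -/
def berezinian {n m : ℕ} {R : Type*} [Ring R] (J : Matrix (Idx n m) (Idx n m) R) : R :=
  leibnizDet (J.toBlocks₁₁ - J.toBlocks₁₂ * Ring.inverse J.toBlocks₂₂ * J.toBlocks₂₁) *
    Ring.inverse (leibnizDet J.toBlocks₂₂)

/-! ### Supermanifolds -/

/-- A superspace over `ℝ`: a topological space with a sheaf of supercommutative real algebras. -/
structure Superspace where
  X : TopCat.{u}
  sheaf : TopCat.Sheaf (AlgCat.{u} ℝ) X
  /-- The even (`p = 0`) and odd (`p = 1`) sections. -/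
  part (U : TopologicalSpace.Opens X) (p : ZMod 2) :
    Submodule ℝ (sheaf.obj.obj (Opposite.op U))
  isInternal (U : TopologicalSpace.Opens X) : DirectSum.IsInternal (part U)
  one_mem (U : TopologicalSpace.Opens X) : 1 ∈ part U 0
  mul_mem (U : TopologicalSpace.Opens X) {p q : ZMod 2}
    {f g : sheaf.obj.obj (Opposite.op U)} (hf : f ∈ part U p) (hg : g ∈ part U q) :
    f * g ∈ part U (p + q)
  supercomm (U : TopologicalSpace.Opens X) {p q : ZMod 2}
    {f g : sheaf.obj.obj (Opposite.op U)} (hf : f ∈ part U p) (hg : g ∈ part U q) :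
    f * g = sgn (p * q) • (g * f)
  res_mem {U W : TopologicalSpace.Opens X} (h : W ≤ U) {p : ZMod 2}
    {f : sheaf.obj.obj (Opposite.op U)} (hf : f ∈ part U p) :
    (sheaf.obj.map (CategoryTheory.homOfLE h).op).hom f ∈ part W p

namespace Superspace

/-- The algebra of functions over an open set. -/
abbrev Fun (M : Superspace.{u}) (U : TopologicalSpace.Opens M.X) : Type u :=
  M.sheaf.obj.obj (Opposite.op U)

/-- Restriction of functions. -/
def res (M : Superspace.{u}) {U W : TopologicalSpace.Opens M.X} (h : W ≤ U) :
    M.Fun U →ₐ[ℝ] M.Fun W :=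
  (M.sheaf.obj.map (CategoryTheory.homOfLE h).op).hom

end Superspace

/-- The image of an open subset of the domain of a local homeomorphism. -/
def imageOpens {X Y : Type*} [TopologicalSpace X] [TopologicalSpace Y]
    (e : OpenPartialHomeomorph X Y) (W : TopologicalSpace.Opens X) (h : (W : Set X) ⊆ e.source) :
    TopologicalSpace.Opens Y :=
  ⟨e '' W, e.isOpen_image_of_subset_source W.2 h⟩

/-- A coordinate system with `n` even and `m` odd coordinates on an open set `dom` of a superspace:
an isomorphism, as superspaces, of `dom` with a superdomain, i.e., a homeomorphism of `dom` with an
open set of `ℝⁿ` and a compatible isomorphism of sheaves of superalgebras. -/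
structure Chart (M : Superspace.{u}) (n m : ℕ) where
  homeo : OpenPartialHomeomorph M.X (Fin n → ℝ)
  dom : TopologicalSpace.Opens M.X
  dom_eq : (dom : Set M.X) = homeo.source
  iso (W : TopologicalSpace.Opens M.X) (h : W ≤ dom) :
    M.Fun W ≃ₐ[ℝ] Model m (imageOpens homeo W (dom_eq ▸ h))
  iso_res {W W' : TopologicalSpace.Opens M.X} (h : W ≤ dom) (h' : W' ≤ W) (f : M.Fun W) :
    iso W' (h'.trans h) (M.res h' f) = Model.res m (Set.image_mono h') (iso W h f)
  iso_part (W : TopologicalSpace.Opens M.X) (h : W ≤ dom) (p : ZMod 2) (f : M.Fun W) :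
    f ∈ M.part W p ↔ iso W h f ∈ Model.part m (imageOpens homeo W (dom_eq ▸ h)) p

namespace Chart

variable {M : Superspace.{u}} {n m : ℕ} (φ : Chart M n m)

/-- The coordinate functions of a coordinate system. -/
def coord (W : TopologicalSpace.Opens M.X) (h : W ≤ φ.dom) (a : Idx n m) : M.Fun W :=
  (φ.iso W h).symm (Model.coord m _ a)

/-- The partial derivative with respect to a coordinate. -/
def pd (W : TopologicalSpace.Opens M.X) (h : W ≤ φ.dom) (a : Idx n m) : M.Fun W →ₗ[ℝ] M.Fun W :=
  (φ.iso W h).symm.toLinearMap ∘ₗ Model.pd m _ a ∘ₗ (φ.iso W h).toLinearMap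

/-- The exponential of an even function on the domain of a coordinate system. -/
def exp (f : M.Fun φ.dom) : M.Fun φ.dom :=
  (φ.iso φ.dom le_rfl).symm (Model.exp m (φ.iso φ.dom le_rfl f))

/-- The Jacobian matrix `∂y/∂x`, on the common domain, of the coordinates `y` of `ψ` with respect
to the coordinates `x` of `φ`; rows are indexed by the `x`, columns by the `y`. -/
def jacobian (φ ψ : Chart M n m) : Matrix (Idx n m) (Idx n m) (M.Fun (φ.dom ⊓ ψ.dom)) :=
  fun b c => φ.pd _ inf_le_left b (ψ.coord _ inf_le_right c)

end Chart

/-- A smooth supermanifold of dimension `n|m`. -/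
structure Supermanifold (n m : ℕ) extends Superspace.{u} where
  t2 : T2Space X
  secondCountable : SecondCountableTopology X
  locallyTrivial (x : X) : ∃ φ : Chart toSuperspace n m, x ∈ φ.dom

/-- A (real) function on the supermanifold `M`. -/
abbrev Supermanifold.GlobalFun {n m : ℕ} (M : Supermanifold.{u} n m) : Type u := M.Fun ⊤

/-- The coordinate systems of a supermanifold. -/
abbrev Supermanifold.Coords {n m : ℕ} (M : Supermanifold.{u} n m) : Type u :=
  Chart M.toSuperspace n m

/-! ### Odd Poisson structures -/

/-- The bracket `{f, g} = -∑ (-1)^{f̃(ã+1)} S^{ab} ∂f/∂x^b ∂g/∂x^a` in a coordinate system, where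
`p` is the parity of `f`. -/
def localBracket {M : Superspace.{u}} {n m : ℕ} (φ : Chart M n m)
    (S : Idx n m → Idx n m → M.Fun φ.dom) (p : ZMod 2) (f g : M.Fun φ.dom) : M.Fun φ.dom :=
  -∑ a, ∑ b, sgn (p * (par a + 1)) • (S a b * φ.pd _ le_rfl b f * φ.pd _ le_rfl a g)

/-- An odd Poisson (Schouten) structure on a supermanifold: an odd function
`½ S^{ab} p_b p_a` on the cotangent bundle that is quadratic in the momenta, given by its
components `S^{ab}` in all coordinate systems, whose bracket satisfies the Jacobi identity. -/
structure OddPoissonStructure {n m : ℕ} (M : Supermanifold.{u} n m) where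
  comp (φ : M.Coords) (a b : Idx n m) : M.Fun φ.dom
  comp_mem (φ : M.Coords) (a b : Idx n m) : comp φ a b ∈ M.part φ.dom (par a + par b + 1)
  comp_symm (φ : M.Coords) (a b : Idx n m) : comp φ a b = sgn (par a * par b) • comp φ b a
  /-- The transformation law that results from `p_a = (∂y^c/∂x^a) p'_c`. -/
  transform (φ ψ : M.Coords) (c d : Idx n m) :
    M.res (inf_le_right : φ.dom ⊓ ψ.dom ≤ ψ.dom) (comp ψ c d) =
      ∑ a, ∑ b, sgn (par d * (par a + par c)) •
        (M.res (inf_le_left : φ.dom ⊓ ψ.dom ≤ φ.dom) (comp φ a b) *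
          φ.jacobian ψ b d * φ.jacobian ψ a c)
  jacobi (φ : M.Coords) (p q r : ZMod 2) (f g h : M.Fun φ.dom)
    (hf : f ∈ M.part φ.dom p) (hg : g ∈ M.part φ.dom q) (hh : h ∈ M.part φ.dom r) :
    localBracket φ (comp φ) p f (localBracket φ (comp φ) q g h) =
      localBracket φ (comp φ) (p + q + 1) (localBracket φ (comp φ) p f g) h +
        sgn ((p + 1) * (q + 1)) •
          localBracket φ (comp φ) q g (localBracket φ (comp φ) p f h)

/-- The components `X_f^a = X_f(x^a)` in a coordinate system of the Hamiltonian vector field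
`X_f = (-1)^{f̃+1} {f, ·}` of a function `f` of parity `p`; the parity of `X_f` is `p + 1`. -/
def OddPoissonStructure.hamiltonianField {n m : ℕ} {M : Supermanifold.{u} n m}
    (P : OddPoissonStructure M) (φ : M.Coords) (p : ZMod 2) (f : M.Fun φ.dom) (a : Idx n m) :
    M.Fun φ.dom :=
  sgn (p + 1) • localBracket φ (P.comp φ) p f (φ.coord _ le_rfl a)

/-! ### Volume forms, divergence, Laplacian -/

/-- A (non-degenerate, even) volume form, i.e., a basis element `ρ = ρ(x) Dx` of the module of
sections of the Berezinian, given by its coefficients `ρ(x)` in all coordinate systems. -/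
@[ext]
structure VolumeForm {n m : ℕ} (M : Supermanifold.{u} n m) where
  coeff (φ : M.Coords) : M.Fun φ.dom
  coeff_even (φ : M.Coords) : coeff φ ∈ M.part φ.dom 0
  isUnit (φ : M.Coords) : IsUnit (coeff φ)
  /-- `Dy = Ber(∂y/∂x) Dx`. -/
  transform (φ ψ : M.Coords) :
    M.res (inf_le_left : φ.dom ⊓ ψ.dom ≤ φ.dom) (coeff φ) =
      M.res (inf_le_right : φ.dom ⊓ ψ.dom ≤ ψ.dom) (coeff ψ) * berezinian (φ.jacobian ψ)

/-- The coefficient `∑ (-1)^{ã(X̃+1)} ∂(ρ X^a)/∂x^a` of the Lie derivative `L_X ρ` along a vector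
field `X = X^a ∂/∂x^a` of parity `q`. -/
def lieVolume {n m : ℕ} {M : Supermanifold.{u} n m} (ρ : VolumeForm M) (φ : M.Coords) (q : ZMod 2)
    (X : Idx n m → M.Fun φ.dom) : M.Fun φ.dom :=
  ∑ a, sgn (par a * (q + 1)) • φ.pd _ le_rfl a (ρ.coeff φ * X a)

/-- The divergence `(L_X ρ) / ρ` of a vector field `X` of parity `q`. -/
def divergence {n m : ℕ} {M : Supermanifold.{u} n m} (ρ : VolumeForm M) (φ : M.Coords) (q : ZMod 2)
    (X : Idx n m → M.Fun φ.dom) : M.Fun φ.dom :=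
  Ring.inverse (ρ.coeff φ) * lieVolume ρ φ q X

/-- The odd Laplace operator `Δ_ρ f = div_ρ X_f`, in a coordinate system, on functions of
parity `p`. -/
def laplacian {n m : ℕ} {M : Supermanifold.{u} n m} (P : OddPoissonStructure M)
    (ρ : VolumeForm M) (φ : M.Coords) (p : ZMod 2) (f : M.Fun φ.dom) : M.Fun φ.dom :=
  divergence ρ φ (p + 1) (P.hamiltonianField φ p f)

/-- `σ` is an even function on `M`. -/
def IsEven {n m : ℕ} {M : Supermanifold.{u} n m} (σ : M.GlobalFun) : Prop := σ ∈ M.part ⊤ 0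

/-- `ρ' = e^σ ρ`. -/
def IsExpMul {n m : ℕ} {M : Supermanifold.{u} n m} (σ : M.GlobalFun) (ρ ρ' : VolumeForm M) : Prop :=
  ∀ φ : M.Coords, ρ'.coeff φ = φ.exp (M.res le_top σ) * ρ.coeff φ

/-- `Δ_ρ e^f = 0`, for an even function `f`. -/
def LaplacianExpEqZero {n m : ℕ} {M : Supermanifold.{u} n m} (P : OddPoissonStructure M)
    (ρ : VolumeForm M) (f : M.GlobalFun) : Prop :=
  ∀ φ : M.Coords, laplacian P ρ φ 0 (φ.exp (M.res le_top f)) = 0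

/-- The arrows `ρ → ρ' = e^σ ρ` with `Δ_ρ e^{σ/2} = 0`. -/
def MasterArrow {n m : ℕ} {M : Supermanifold.{u} n m} (P : OddPoissonStructure M)
    (ρ ρ' : VolumeForm M) : Type u :=
  {σ : M.GlobalFun // IsEven σ ∧ IsExpMul σ ρ ρ' ∧ LaplacianExpEqZero P ρ ((1 / 2 : ℝ) • σ)}

end OddPoisson

end

noncomputable section

namespace OddPoisson

/-! ### Exponentials of nilpotent elements -/

/-! Everything is local. On an even function `f` all signs disappear and `Δ_ρ f = ρ⁻¹ L_ρ f` with
`L_ρ f = ∑ ∂ₐ(ρ Sᵃᵇ ∂_b f)`; as `ρ` is invertible, `Δ_ρ f = 0` means `L_ρ f = 0`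
(`laplacian_zero_eq_zero_iff`).

Put `F = e^{σ/2}` and `G = e^{τ/2}`, so that `ρ' = F²ρ`. The pairing `∂ₐG Sᵃᵇ ∂_b F`, summed over
the indices, is symmetric in `F` and `G` (`pd_mul_comp_mul_pd`), and the Leibniz rule then gives `F
· L_ρ(FG) = FG · L_ρ F + L_{F²ρ} G` (`divGrad_mul`). Both terms on the right vanish by hypothesis,
and `F` is invertible, so `L_ρ(FG) = 0`: arrows compose. For inverses, `F² ∂(F⁻¹) = -∂F` gives
`L_{F²ρ}(F⁻¹) = -L_ρ F` (`divGrad_inverse`).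

The rest justifies this calculus on superdomains: even functions are central and satisfy the Leibniz
rule without signs, and the exponential, a finite sum in the nilpotent part, turns sums of even
functions into products (`Model.exp_add`). -/

theorem sum_inv_factorial_smul_pow_add {A : Type*} [Ring A] [Algebra ℝ A] {a b : A} {k : ℕ}
    (hab : Commute a b) (ha : a ^ k = 0) (hb : b ^ k = 0) (h : (a + b) ^ k = 0) :
    ∑ i ∈ Finset.range k, ((i.factorial : ℝ)⁻¹) • (a + b) ^ i =
      (∑ i ∈ Finset.range k, ((i.factorial : ℝ)⁻¹) • a ^ i) *
        ∑ i ∈ Finset.range k, ((i.factorial : ℝ)⁻¹) • b ^ i := by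
  -- `IsNilpotent.exp` has rational coefficients, so the real scalars are restricted to `ℚ`.
  let _ : Module ℚ A := Module.compHom A (algebraMap ℚ ℝ)
  have key : ∀ c : A, c ^ k = 0 →
      IsNilpotent.exp c = ∑ i ∈ Finset.range k, ((i.factorial : ℝ)⁻¹) • c ^ i := fun c hc => by
    rw [IsNilpotent.exp_eq_sum hc]
    refine Finset.sum_congr rfl fun i _ => ?_
    change (algebraMap ℚ ℝ (i.factorial : ℚ)⁻¹) • c ^ i = _
    simp
  rw [← key _ ha, ← key _ hb, ← key _ h]
  exact IsNilpotent.exp_add_of_commute hab ⟨k, ha⟩ ⟨k, hb⟩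

/-! ### The Grassmann algebra -/

namespace Grassmann

variable {m : ℕ}

/-- The linear span of the generators of the Grassmann algebra. -/
abbrev gens (m : ℕ) : Submodule ℝ (Grassmann m) :=
  LinearMap.range (ExteriorAlgebra.ι ℝ : (Fin m → ℝ) →ₗ[ℝ] Grassmann m)

/-- Any `m + 1` vectors of `ℝᵐ` are linearly dependent, and an alternating map kills dependent
families. -/
theorem gens_pow_eq_bot : gens m ^ (m + 1) = ⊥ := by
  change ⋀[ℝ]^(m + 1) (Fin m → ℝ) = ⊥
  rw [← ExteriorAlgebra.ιMulti_span_fixedDegree, Submodule.span_eq_bot]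
  rintro _ ⟨v, rfl⟩
  refine AlternatingMap.map_linearDependent _ _ fun h => ?_
  simpa using h.fintype_card_le_finrank

/-- A product ending in a generator either already begins with one or has a scalar in front. This
makes the right ideal `gens m * ⊤` two-sided, so that generators can be collected on the left. -/
theorem top_mul_gens_le : (⊤ : Submodule ℝ (Grassmann m)) * gens m ≤ gens m * ⊤ := by
  refine Submodule.mul_le.2 ?_
  rintro x - _ ⟨v, rfl⟩
  induction x using CliffordAlgebra.left_induction with
  | algebraMap r =>
    rw [Algebra.commutes]
    exact Submodule.mul_mem_mul ⟨v, rfl⟩ trivial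
  | add x y hx hy => rw [add_mul]; exact add_mem hx hy
  | ι_mul x a _ =>
    rw [mul_assoc]
    exact Submodule.mul_mem_mul ⟨a, rfl⟩ trivial

theorem sub_algebraMapInv_mem (w : Grassmann m) :
    w - algebraMap ℝ _ (ExteriorAlgebra.algebraMapInv w) ∈ gens m * ⊤ := by
  induction w using CliffordAlgebra.left_induction with
  | algebraMap r =>
    have : ExteriorAlgebra.algebraMapInv (algebraMap ℝ (Grassmann m) r) = r := by simp
    erw [this]
    simp
  | add x y hx hy =>
    rw [map_add, map_add, add_sub_add_comm]
    exact add_mem hx hy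
  | ι_mul x a _ =>
    have : ExteriorAlgebra.algebraMapInv (ExteriorAlgebra.ι ℝ a : Grassmann m) = 0 := by
      simp [ExteriorAlgebra.algebraMapInv]
    have h2 : ExteriorAlgebra.algebraMapInv (ExteriorAlgebra.ι ℝ a * x : Grassmann m) = 0 := by
      rw [map_mul, this, zero_mul]
    erw [h2]
    rw [map_zero, sub_zero]
    exact Submodule.mul_mem_mul ⟨a, rfl⟩ trivial

theorem pow_mul_top_mul_le (k : ℕ) :
    (gens m ^ k * ⊤) * (gens m * ⊤) ≤ gens m ^ (k + 1) * (⊤ : Submodule ℝ (Grassmann m)) := by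
  calc (gens m ^ k * ⊤) * (gens m * ⊤) = gens m ^ k * (⊤ * gens m) * ⊤ := by
        simp only [mul_assoc]
    _ ≤ gens m ^ k * (gens m * ⊤) * ⊤ := by gcongr ?_ * _; gcongr _ * ?_; exact top_mul_gens_le
    _ = gens m ^ (k + 1) * (⊤ * ⊤) := by simp only [mul_assoc, pow_succ]
    _ ≤ _ := by gcongr; exact le_top

/-- Even elements of the Grassmann algebra are central. -/
theorem commute_of_even {w : Grassmann m}
    (hw : w ∈ CliffordAlgebra.evenOdd (0 : QuadraticForm ℝ (Fin m → ℝ)) 0) (x : Grassmann m) :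
    Commute w x := by
  have anti : ∀ a b : Fin m → ℝ, (ExteriorAlgebra.ι ℝ a * ExteriorAlgebra.ι ℝ b : Grassmann m) =
      -(ExteriorAlgebra.ι ℝ b * ExteriorAlgebra.ι ℝ a) := fun a b =>
    eq_neg_of_add_eq_zero_left (ExteriorAlgebra.ι_add_mul_swap a b)
  induction w, hw using CliffordAlgebra.even_induction with
  | algebraMap r => exact Algebra.commutes r x
  | add y z hy hz h1 h2 => exact h1.add_left h2
  | ι_mul_ι_mul a b y hy h =>
    refine Commute.mul_left ?_ h
    clear h
    induction x using CliffordAlgebra.left_induction with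
    | algebraMap r => exact (Algebra.commutes r _).symm
    | add y z h1 h2 => exact h1.add_right h2
    | ι_mul y c h =>
      refine Commute.mul_right ?_ h
      change ExteriorAlgebra.ι ℝ a * ExteriorAlgebra.ι ℝ b * ExteriorAlgebra.ι ℝ c =
        ExteriorAlgebra.ι ℝ c * (ExteriorAlgebra.ι ℝ a * ExteriorAlgebra.ι ℝ b)
      -- Moving `c` past `b` and then past `a` costs two signs, which cancel.
      rw [mul_assoc, anti b c, mul_neg, ← mul_assoc, anti a c, neg_mul, neg_neg, mul_assoc]

/-- Contraction is an antiderivation; the sign it picks up on passing an even factor is `+1`. -/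
theorem contractLeft_mul_of_even (d : Module.Dual ℝ (Fin m → ℝ)) {w : Grassmann m}
    (hw : w ∈ CliffordAlgebra.evenOdd (0 : QuadraticForm ℝ (Fin m → ℝ)) 0) (x : Grassmann m) :
    CliffordAlgebra.contractLeft d (w * x) =
      CliffordAlgebra.contractLeft d w * x + w * CliffordAlgebra.contractLeft d x := by
  induction w, hw using CliffordAlgebra.even_induction with
  | algebraMap r =>
    erw [CliffordAlgebra.contractLeft_algebraMap_mul, CliffordAlgebra.contractLeft_algebraMap]
    rw [zero_mul, zero_add]
  | add y z hy hz h1 h2 =>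
    rw [add_mul, map_add, h1, h2, map_add]
    noncomm_ring
  | ι_mul_ι_mul a b y hy h =>
    simp only [mul_assoc, CliffordAlgebra.contractLeft_ι_mul, h, mul_sub, sub_mul, mul_add,
      smul_mul_assoc, mul_smul_comm]
    abel

theorem contractLeft_mem_odd (d : Module.Dual ℝ (Fin m → ℝ)) {w : Grassmann m}
    (hw : w ∈ CliffordAlgebra.evenOdd (0 : QuadraticForm ℝ (Fin m → ℝ)) 0) :
    CliffordAlgebra.contractLeft d w ∈
      CliffordAlgebra.evenOdd (0 : QuadraticForm ℝ (Fin m → ℝ)) 1 := by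
  induction w, hw using CliffordAlgebra.even_induction with
  | algebraMap r =>
    erw [CliffordAlgebra.contractLeft_algebraMap]
    exact zero_mem _
  | add y z hy hz h1 h2 => rw [map_add]; exact add_mem h1 h2
  | ι_mul_ι_mul a b y hy h =>
    have hι : ∀ c : Fin m → ℝ, CliffordAlgebra.ι (0 : QuadraticForm ℝ (Fin m → ℝ)) c ∈
        CliffordAlgebra.evenOdd (0 : QuadraticForm ℝ (Fin m → ℝ)) 1 :=
      CliffordAlgebra.ι_mem_evenOdd_one _
    have hmul : ∀ (c : Fin m → ℝ) (p : ZMod 2) (z : Grassmann m),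
        z ∈ CliffordAlgebra.evenOdd (0 : QuadraticForm ℝ (Fin m → ℝ)) p →
        CliffordAlgebra.ι (0 : QuadraticForm ℝ (Fin m → ℝ)) c * z ∈
          CliffordAlgebra.evenOdd (0 : QuadraticForm ℝ (Fin m → ℝ)) (1 + p) := fun c p z hz =>
      SetLike.mul_mem_graded (hι c) hz
    rw [mul_assoc, CliffordAlgebra.contractLeft_ι_mul, CliffordAlgebra.contractLeft_ι_mul]
    have e : (1 : ZMod 2) + 1 = 0 := rfl
    refine sub_mem (Submodule.smul_mem _ _ ?_) ?_
    · simpa using hmul b 0 y hy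
    · have := hmul a 0 (d b • y - CliffordAlgebra.ι _ b * CliffordAlgebra.contractLeft d y)
        (sub_mem (Submodule.smul_mem _ _ hy) (by simpa [e] using hmul b 1 _ h))
      simpa using this

end Grassmann

/-! ### Smooth functions -/

namespace Smooth

variable {n : ℕ} {V : TopologicalSpace.Opens (Fin n → ℝ)}

theorem pd_mul (i : Fin n) (f g : Smooth V) :
    Smooth.pd V i (f * g) = Smooth.pd V i f * g + f * Smooth.pd V i g := by
  ext x
  have key : ∀ k : Smooth V, DifferentiableAt ℝ (ext0 k.1) x.1 := fun k =>
    (ContDiffOn.contDiffAt k.2 (V.2.mem_nhds x.2)).differentiableAt (by simp)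
  have e : ext0 (f * g).1 = ext0 f.1 * ext0 g.1 := by
    funext y
    by_cases hy : y ∈ V
    · simp [ext0_apply _ hy]
    · have hn : ¬ ∃ a : V, (a : Fin n → ℝ) = y := fun ⟨a, ha⟩ => hy (ha ▸ a.2)
      simp [ext0, Function.extend_apply' _ _ _ hn]
  change fderiv ℝ (ext0 (f * g).1) x.1 _ =
    fderiv ℝ (ext0 f.1) x.1 _ * g.1 x + f.1 x * fderiv ℝ (ext0 g.1) x.1 _
  rw [e, fderiv_mul (key f) (key g)]
  simp [ext0_apply _ x.2]
  ring

theorem pd_coord (i j : Fin n) :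
    Smooth.pd V i (Smooth.coord V j) = if i = j then 1 else 0 := by
  ext x
  -- The extension by zero agrees with the linear coordinate only on `V`, but the derivative sees
  -- only the germ at `x`.
  have e : ext0 (Smooth.coord V j).1 =ᶠ[nhds x.1] fun y => y j :=
    Filter.eventually_of_mem (V.2.mem_nhds x.2) fun y hy => ext0_apply _ hy
  change fderiv ℝ (ext0 (Smooth.coord V j).1) x.1 (Pi.single i 1) = _
  rw [e.fderiv_eq, fderiv_apply differentiableAt_fun_id]
  by_cases h : i = j
  · subst h; simp
  · simp [h, Ne.symm h]

theorem pd_one (i : Fin n) : Smooth.pd V i 1 = 0 := by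
  have h := Smooth.pd_mul i (1 : Smooth V) 1
  rw [mul_one, mul_one, one_mul] at h
  exact left_eq_add.1 h

theorem exp_zero : Smooth.exp (0 : Smooth V) = 1 := by
  ext x
  exact Real.exp_zero

theorem exp_add (f g : Smooth V) : Smooth.exp (f + g) = Smooth.exp f * Smooth.exp g := by
  ext x
  exact Real.exp_add _ _

end Smooth

/-! ### Functions on superdomains -/

namespace Model

variable {n m : ℕ} {V : TopologicalSpace.Opens (Fin n → ℝ)}

instance instRing : Ring (Model m V) := Algebra.TensorProduct.instRing

instance instAddCommGroup : AddCommGroup (Model m V) := instRing.toAddCommGroup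

theorem tmul_mem_part {p : ZMod 2} (s : Smooth V) {w : Grassmann m}
    (hw : w ∈ CliffordAlgebra.evenOdd (0 : QuadraticForm ℝ (Fin m → ℝ)) p) :
    s ⊗ₜ w ∈ part m V p := ⟨s ⊗ₜ ⟨w, hw⟩, rfl⟩

theorem part_induction {p : ZMod 2} {motive : ∀ f : Model m V, f ∈ part m V p → Prop}
    (zero : motive 0 (zero_mem _))
    (tmul : ∀ (s : Smooth V) (w : Grassmann m)
      (hw : w ∈ CliffordAlgebra.evenOdd (0 : QuadraticForm ℝ (Fin m → ℝ)) p),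
      motive (s ⊗ₜ w) (tmul_mem_part s hw))
    (add : ∀ f g hf hg, motive f hf → motive g hg → motive (f + g) (add_mem hf hg))
    (f : Model m V) (hf : f ∈ part m V p) : motive f hf := by
  obtain ⟨x, rfl⟩ := hf
  induction x using TensorProduct.induction_on with
  | zero => simpa using! zero
  | tmul s w => exact tmul s w.1 w.2
  | add x y hx hy => simpa using! add _ _ _ _ hx hy

theorem tmul_one_mem_part (s : Smooth V) : s ⊗ₜ (1 : Grassmann m) ∈ part m V 0 :=
  tmul_mem_part s (SetLike.one_mem_graded _)

theorem mul_mem_part {f g : Model m V} (hf : f ∈ part m V 0) (hg : g ∈ part m V 0) :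
    f * g ∈ part m V 0 := by
  induction f, hf using part_induction with
  | zero => rw [zero_mul]; exact zero_mem _
  | add f f' _ _ h h' => rw [add_mul]; exact add_mem h h'
  | tmul s w hw =>
    induction g, hg using part_induction with
    | zero => rw [mul_zero]; exact zero_mem _
    | add f f' _ _ h h' => rw [mul_add]; exact add_mem h h'
    | tmul t v hv =>
      rw [Algebra.TensorProduct.tmul_mul_tmul]
      exact tmul_mem_part _ (by simpa using SetLike.mul_mem_graded hw hv)

theorem pow_mem_part {f : Model m V} (hf : f ∈ part m V 0) (k : ℕ) : f ^ k ∈ part m V 0 := by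
  induction k with
  | zero => rw [pow_zero]; exact tmul_one_mem_part 1
  | succ k ih => rw [pow_succ]; exact mul_mem_part ih hf

theorem exp_mem_part {f : Model m V} (hf : f ∈ part m V 0) : exp m f ∈ part m V 0 :=
  mul_mem_part (tmul_one_mem_part _) <| sum_mem fun k _ => Submodule.smul_mem _ _ <|
    pow_mem_part (sub_mem hf (tmul_one_mem_part _)) k

theorem commute_of_mem_part {f : Model m V} (hf : f ∈ part m V 0) (g : Model m V) :
    Commute f g := by
  induction f, hf using part_induction with
  | zero => exact Commute.zero_left _
  | add f f' _ _ h h' => exact h.add_left h'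
  | tmul s w hw =>
    induction g using TensorProduct.induction_on with
    | zero => exact Commute.zero_right _
    | add g g' h h' => exact h.add_right h'
    | tmul t v =>
      change s ⊗ₜ w * t ⊗ₜ v = t ⊗ₜ v * s ⊗ₜ w
      rw [Algebra.TensorProduct.tmul_mul_tmul, Algebra.TensorProduct.tmul_mul_tmul, mul_comm s,
        (Grassmann.commute_of_even hw v).eq]

/-- The sign in the Leibniz rule for left derivatives comes from passing `f` alone, so `g` may be
arbitrary. -/
theorem pd_mul {f : Model m V} (hf : f ∈ part m V 0) (a : Idx n m) (g : Model m V) :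
    pd m V a (f * g) = pd m V a f * g + f * pd m V a g := by
  induction f, hf using part_induction with
  | zero => simp
  | add f f' _ _ h h' => simp only [add_mul, map_add, h, h']; abel
  | tmul s w hw =>
    induction g using TensorProduct.induction_on with
    | zero => simp
    | add g g' h h' => simp only [mul_add, map_add, h, h']; abel
    | tmul t v =>
      rw [Algebra.TensorProduct.tmul_mul_tmul]
      cases a with
      | inl i =>
        simp only [pd, LinearMap.rTensor_tmul, Algebra.TensorProduct.tmul_mul_tmul,
          Smooth.pd_mul, TensorProduct.add_tmul]
      | inr j =>
        simp only [pd, LinearMap.lTensor_tmul, Algebra.TensorProduct.tmul_mul_tmul,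
          Grassmann.contractLeft_mul_of_even _ hw, TensorProduct.tmul_add]

theorem pd_mem_part {f : Model m V} (hf : f ∈ part m V 0) (a : Idx n m) :
    pd m V a f ∈ part m V (par a) := by
  induction f, hf using part_induction with
  | zero => rw [map_zero]; exact zero_mem _
  | add f f' _ _ h h' => rw [map_add]; exact add_mem h h'
  | tmul s w hw =>
    cases a with
    | inl i => exact tmul_mem_part _ hw
    | inr j => exact tmul_mem_part _ (Grassmann.contractLeft_mem_odd _ hw)

theorem body_tmul (s : Smooth V) (w : Grassmann m) :
    body m V (s ⊗ₜ w) = ExteriorAlgebra.algebraMapInv w • s := by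
  simp [body]

/-- The span of the elements `s ⊗ w`, where `w` has degree at least `k`. -/
def filtration (m : ℕ) (V : TopologicalSpace.Opens (Fin n → ℝ)) (k : ℕ) :
    Submodule ℝ (Model m V) :=
  Submodule.span ℝ {f | ∃ (s : Smooth V), ∃ w ∈ Grassmann.gens m ^ k * ⊤, s ⊗ₜ w = f}

theorem filtration_mul_le (k : ℕ) :
    filtration m V k * filtration m V 1 ≤ filtration m V (k + 1) := by
  rw [filtration, filtration, Submodule.span_mul_span, Submodule.span_le]
  rintro _ ⟨_, ⟨s, w, hw, rfl⟩, _, ⟨t, v, hv, rfl⟩, rfl⟩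
  refine Submodule.subset_span
    ⟨s * t, w * v, ?_, (Algebra.TensorProduct.tmul_mul_tmul s t w v).symm⟩
  rw [pow_one] at hv
  exact Grassmann.pow_mul_top_mul_le k (Submodule.mul_mem_mul hw hv)

theorem soul_mem_filtration (f : Model m V) : f - body m V f ⊗ₜ 1 ∈ filtration m V 1 := by
  induction f using TensorProduct.induction_on with
  | zero => simp
  | add f g hf hg =>
    rw [map_add, TensorProduct.add_tmul, add_sub_add_comm]
    exact add_mem hf hg
  | tmul s w =>
    rw [body_tmul, TensorProduct.smul_tmul, ← TensorProduct.tmul_sub,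
      ← Algebra.algebraMap_eq_smul_one]
    refine Submodule.subset_span ⟨s, _, ?_, rfl⟩
    rw [pow_one]
    exact Grassmann.sub_algebraMapInv_mem w

/-- Each factor raises the Grassmann degree by at least one, and degree `m + 1` is zero. Hence the
truncated sum in `Model.exp` is the full exponential series. -/
theorem soul_pow_eq_zero (f : Model m V) : (f - body m V f ⊗ₜ 1) ^ (m + 1) = 0 := by
  have h : ∀ k, (f - body m V f ⊗ₜ 1) ^ (k + 1) ∈ filtration m V (k + 1) := fun k => by
    induction k with
    | zero => rw [zero_add, pow_one]; exact soul_mem_filtration f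
    | succ k ih =>
      rw [pow_succ]
      exact filtration_mul_le _ (Submodule.mul_mem_mul ih (soul_mem_filtration f))
  have hbot : filtration m V (m + 1) = ⊥ := by
    rw [filtration, Submodule.span_eq_bot]
    rintro _ ⟨s, w, hw, rfl⟩
    rw [Grassmann.gens_pow_eq_bot, Submodule.bot_mul, Submodule.mem_bot] at hw
    rw [hw, TensorProduct.tmul_zero]
  simpa [hbot] using h m

theorem exp_zero : exp m (0 : Model m V) = 1 := by
  rw [exp, map_zero, Smooth.exp_zero, TensorProduct.zero_tmul, sub_zero, Finset.sum_range_succ',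
    Finset.sum_eq_zero fun k _ => by rw [zero_pow k.succ_ne_zero, smul_zero]]
  simp [Algebra.TensorProduct.one_def]

/-- Bodies and nilpotent parts add separately. Evenness of `f` alone suffices, because its nilpotent
part is then central. -/
theorem exp_add {f : Model m V} (hf : f ∈ part m V 0) (g : Model m V) :
    exp m (f + g) = exp m f * exp m g := by
  have e : f + g - body m V (f + g) ⊗ₜ 1 =
      (f - body m V f ⊗ₜ 1) + (g - body m V g ⊗ₜ 1) := by
    rw [map_add, TensorProduct.add_tmul, add_sub_add_comm]
  have hc := commute_of_mem_part (sub_mem hf (tmul_one_mem_part (body m V f)))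
    (g - body m V g ⊗ₜ 1)
  rw [exp, e, sum_inv_factorial_smul_pow_add hc (soul_pow_eq_zero f) (soul_pow_eq_zero g)
    (e ▸ soul_pow_eq_zero (f + g)), map_add, Smooth.exp_add, exp, exp]
  rw [← mul_one (1 : Grassmann m), ← Algebra.TensorProduct.tmul_mul_tmul, mul_one]
  rw [mul_assoc, mul_assoc, ← mul_assoc (_ ⊗ₜ 1) (Finset.sum _ _),
    (commute_of_mem_part (tmul_one_mem_part (Smooth.exp (body m V g))) _).eq, mul_assoc,
    (commute_of_mem_part (tmul_one_mem_part (Smooth.exp (body m V g))) _).eq]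

theorem pd_coord (a b : Idx n m) :
    pd m V a (coord m V b) = if a = b then 1 else 0 := by
  cases a with
  | inl i =>
    cases b with
    | inl j =>
      simp only [pd, coord, LinearMap.rTensor_tmul, Smooth.pd_coord, Sum.inl.injEq]
      split_ifs
      · rfl
      · rw [TensorProduct.zero_tmul]
    | inr j =>
      rw [if_neg (by simp), coord, pd, LinearMap.rTensor_tmul, Smooth.pd_one,
        TensorProduct.zero_tmul]
  | inr i =>
    cases b with
    | inl j =>
      simp only [pd, coord, LinearMap.lTensor_tmul]
      erw [CliffordAlgebra.contractLeft_one]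
      rw [TensorProduct.tmul_zero, if_neg (by simp)]
    | inr j =>
      simp only [pd, coord, LinearMap.lTensor_tmul, Sum.inr.injEq]
      erw [CliffordAlgebra.contractLeft_ι]
      by_cases h : i = j
      · subst h; simp [Algebra.TensorProduct.one_def]
      · simp [h]

end Model

/-! ### Second-order operators `∑ ∂ₐ(ρ Sᵃᵇ ∂_b f)` over a ring -/

/-- The operator `f ↦ ∑ ∂ₐ(ρ ∑ Sᵃᵇ ∂_b f)`. -/
def divGrad {A ι : Type*} [Ring A] [Fintype ι] (D : ι → A →+ A) (S : ι → ι → A) (ρ f : A) : A :=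
  ∑ a, D a (ρ * ∑ b, S a b * D b f)

section divGrad

variable {A ι : Type*} [Ring A] [Fintype ι] {D : ι → A →+ A} {S : ι → ι → A} {ρ F G : A}

/-- Differentiating `F * G = 1` gives `F² ∂G = -∂F`. The weight `F²` is absorbed inside the outer
derivative, so the two sides agree term by term. -/
theorem divGrad_inverse (hD : ∀ a h, D a (F * h) = D a F * h + F * D a h)
    (hD1 : ∀ a, D a 1 = 0) (hF : ∀ h, Commute F h) (hFG : F * G = 1) :
    divGrad D S (F * F * ρ) G = -divGrad D S ρ F := by
  have key : ∀ b, F * (F * D b G) = -D b F := fun b => by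
    have h : F * D b G = -(D b F * G) :=
      eq_neg_of_add_eq_zero_right (by rw [← hD, hFG, hD1])
    rw [h, mul_neg, ← mul_assoc, (hF _).eq, mul_assoc, hFG, mul_one]
  rw [divGrad, divGrad, ← Finset.sum_neg_distrib]
  refine Finset.sum_congr rfl fun a _ => ?_
  rw [← map_neg, ← mul_neg, ← Finset.sum_neg_distrib, ((hF ρ).mul_left (hF ρ)).eq, mul_assoc,
    Finset.mul_sum]
  refine congrArg (fun x => D a (ρ * x)) (Finset.sum_congr rfl fun b _ => ?_)
  rw [← mul_assoc, ((hF _).mul_left (hF _)).eq, mul_assoc, mul_assoc, key, mul_neg]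

/-- With the fluxes `X = ρ S ∂F` and `Y = ρ S ∂G`, the flux of `F * G` is `G X + F Y`, and that of
`G` for the weight `F² ρ` is `F (F Y)`. By symmetry of the pairing, `∑ ∂G X = ∑ ∂F Y`, which matches
the cross terms. -/
theorem divGrad_mul (hDF : ∀ a h, D a (F * h) = D a F * h + F * D a h)
    (hDG : ∀ a h, D a (G * h) = D a G * h + G * D a h)
    (hF : ∀ h, Commute F h) (hG : ∀ h, Commute G h) (hρ : ∀ h, Commute ρ h)
    (hS : ∀ a b, D a G * S a b * D b F = D b F * S b a * D a G) :
    F * divGrad D S ρ (F * G) = F * G * divGrad D S ρ F + divGrad D S (F * F * ρ) G := by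
  set X : ι → A := fun a => ρ * ∑ b, S a b * D b F with hX
  set Y : ι → A := fun a => ρ * ∑ b, S a b * D b G with hY
  have e1 : ∀ a, ρ * ∑ b, S a b * D b (F * G) = G * X a + F * Y a := fun a => by
    simp only [hX, hY, hDF, mul_add, Finset.sum_add_distrib, Finset.mul_sum]
    congr 1 <;> refine Finset.sum_congr rfl fun b _ => ?_
    · rw [(hG _).eq]; simp only [mul_assoc]
    · rw [← mul_assoc (S a b), ← (hF (S a b)).eq, mul_assoc, ← mul_assoc ρ, ← (hF ρ).eq,
        mul_assoc]
  have e2 : ∀ a, F * F * ρ * ∑ b, S a b * D b G = F * (F * Y a) := fun a => by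
    simp only [hY, mul_assoc]
  have cross : ∑ a, D a G * X a = ∑ a, D a F * Y a := by
    have swap : ∀ u v w : A, u * (ρ * (v * w)) = ρ * (u * v * w) := fun u v w => by
      rw [← mul_assoc u, ← (hρ u).eq]; simp only [mul_assoc]
    simp only [hX, hY, Finset.mul_sum, swap]
    rw [Finset.sum_comm]
    exact Finset.sum_congr rfl fun b _ => Finset.sum_congr rfl fun a _ => by rw [hS]
  have l1 : divGrad D S ρ (F * G) =
      ∑ a, D a F * Y a + G * ∑ a, D a (X a) + ∑ a, D a (F * Y a) := by
    simp only [divGrad, e1, map_add, hDG, Finset.sum_add_distrib, cross, Finset.mul_sum]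
  -- Only the outer `F` is differentiated: the remaining `D a (F * Y a)` is left unexpanded, as in
  -- `l1`, and cancels as it stands.
  have l2 : divGrad D S (F * F * ρ) G =
      (∑ a, D a F * (F * Y a)) + F * ∑ a, D a (F * Y a) := by
    simp only [divGrad, e2, Finset.mul_sum, ← Finset.sum_add_distrib]
    exact Finset.sum_congr rfl fun a _ => hDF a _
  have l3 : ∑ a, D a F * (F * Y a) = F * ∑ a, D a F * Y a := by
    rw [Finset.mul_sum]
    refine Finset.sum_congr rfl fun a _ => ?_
    rw [← mul_assoc, ← (hF _).eq, mul_assoc]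
  have l4 : divGrad D S ρ F = ∑ a, D a (X a) := rfl
  rw [l1, l2, l3, l4]
  noncomm_ring

end divGrad

/-! ### Functions on the domain of a coordinate system -/

theorem Superspace.commute_of_even {M : Superspace.{u}} {U : TopologicalSpace.Opens M.X}
    {f : M.Fun U} (hf : f ∈ M.part U 0) (g : M.Fun U) : Commute f g := by
  have hg : g ∈ ⨆ p, M.part U p :=
    (M.isInternal U).submodule_iSup_eq_top ▸ Submodule.mem_top
  induction hg using Submodule.iSup_induction' with
  | mem p g hg =>
    have := M.supercomm U hf hg
    rwa [zero_mul, sgn, if_pos rfl, one_smul] at this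
  | zero => exact Commute.zero_right f
  | add g g' _ _ h h' => exact h.add_right h'

namespace Chart

variable {M : Superspace.{u}} {n m : ℕ} (φ : Chart M n m)

theorem pd_mul {W : TopologicalSpace.Opens M.X} (h : W ≤ φ.dom) (a : Idx n m) {f : M.Fun W}
    (hf : f ∈ M.part W 0) (g : M.Fun W) :
    φ.pd W h a (f * g) = φ.pd W h a f * g + f * φ.pd W h a g := by
  apply (φ.iso W h).injective
  rw [map_add, map_mul (φ.iso W h), map_mul (φ.iso W h)]
  simp only [pd, LinearMap.comp_apply, AlgEquiv.toLinearMap_apply, AlgEquiv.apply_symm_apply]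
  rw [map_mul (φ.iso W h)]
  exact Model.pd_mul ((φ.iso_part W h 0 f).1 hf) a _

theorem pd_mem_part {W : TopologicalSpace.Opens M.X} (h : W ≤ φ.dom) (a : Idx n m) {f : M.Fun W}
    (hf : f ∈ M.part W 0) : φ.pd W h a f ∈ M.part W (par a) := by
  rw [φ.iso_part W h]
  simp only [pd, LinearMap.comp_apply, AlgEquiv.toLinearMap_apply, AlgEquiv.apply_symm_apply]
  exact Model.pd_mem_part ((φ.iso_part W h 0 f).1 hf) a

theorem pd_one {W : TopologicalSpace.Opens M.X} (h : W ≤ φ.dom) (a : Idx n m) :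
    φ.pd W h a 1 = 0 := by
  simpa using φ.pd_mul h a (M.one_mem W) 1

theorem pd_coord {W : TopologicalSpace.Opens M.X} (h : W ≤ φ.dom) (a b : Idx n m) :
    φ.pd W h a (φ.coord W h b) = if a = b then 1 else 0 := by
  apply (φ.iso W h).injective
  simp only [pd, coord, LinearMap.comp_apply, AlgEquiv.toLinearMap_apply,
    AlgEquiv.apply_symm_apply]
  rw [Model.pd_coord]
  split_ifs <;> simp

theorem exp_zero : φ.exp 0 = 1 := by
  rw [exp, map_zero, Model.exp_zero, map_one]

theorem exp_add {f : M.Fun φ.dom} (hf : f ∈ M.part φ.dom 0) (g : M.Fun φ.dom) :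
    φ.exp (f + g) = φ.exp f * φ.exp g := by
  rw [exp, map_add, Model.exp_add ((φ.iso_part _ _ 0 f).1 hf) (φ.iso _ _ g), map_mul, exp, exp]

theorem exp_mem_part {f : M.Fun φ.dom} (hf : f ∈ M.part φ.dom 0) :
    φ.exp f ∈ M.part φ.dom 0 := by
  rw [φ.iso_part _ le_rfl, exp, AlgEquiv.apply_symm_apply]
  exact Model.exp_mem_part ((φ.iso_part _ _ 0 f).1 hf)

theorem exp_mul_exp_neg {f : M.Fun φ.dom} (hf : f ∈ M.part φ.dom 0) :
    φ.exp f * φ.exp (-f) = 1 := by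
  rw [← φ.exp_add hf, add_neg_cancel, exp_zero]

/-- This is where the factor `1/2` enters: it turns the weight `e^σ ρ` into `F * F * ρ`, the form
required by the `divGrad` identities. -/
theorem exp_half_mul_self {f : M.Fun φ.dom} (hf : f ∈ M.part φ.dom 0) :
    φ.exp ((1 / 2 : ℝ) • f) * φ.exp ((1 / 2 : ℝ) • f) = φ.exp f := by
  rw [← φ.exp_add (Submodule.smul_mem _ _ hf), ← add_smul]
  norm_num

end Chart

/-! ### The odd Laplace operator on even functions -/

section

variable {n m : ℕ} {M : Supermanifold.{u} n m} (P : OddPoissonStructure M)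

/-- For even `f` the sign `(-1)^{f̃+1} = -1` cancels the minus in the bracket, and the
index-dependent signs are trivial. -/
theorem hamiltonianField_zero (φ : M.Coords) (f : M.Fun φ.dom) (a : Idx n m) :
    P.hamiltonianField φ 0 f a = ∑ b, P.comp φ a b * φ.pd _ le_rfl b f := by
  have h0 : sgn 0 = 1 := if_pos rfl
  have h1 : sgn (0 + 1) = -1 := if_neg (by decide)
  simp only [OddPoissonStructure.hamiltonianField, localBracket, zero_mul, h0, h1, one_smul,
    neg_smul, neg_neg, Chart.pd_coord, mul_ite, mul_one, mul_zero]
  rw [Finset.sum_comm]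
  simp

theorem laplacian_zero_eq (ρ : VolumeForm M) (φ : M.Coords) (f : M.Fun φ.dom) :
    laplacian P ρ φ 0 f = Ring.inverse (ρ.coeff φ) *
      divGrad (fun a => (φ.pd _ le_rfl a).toAddMonoidHom) (P.comp φ) (ρ.coeff φ) f := by
  -- The Hamiltonian field of an even function is odd, so the exponent `ã(X̃ + 1)` is even.
  have h1 : ∀ a : Idx n m, sgn (par a * (0 + 1 + 1)) = 1 := fun a => by
    rw [show (0 + 1 + 1 : ZMod 2) = 0 from rfl, mul_zero]
    exact if_pos rfl
  simp only [laplacian, divergence, lieVolume, h1, one_smul, hamiltonianField_zero]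
  rfl

theorem laplacian_zero_eq_zero_iff (ρ : VolumeForm M) (φ : M.Coords) (f : M.Fun φ.dom) :
    laplacian P ρ φ 0 f = 0 ↔
      divGrad (fun a => (φ.pd _ le_rfl a).toAddMonoidHom) (P.comp φ) (ρ.coeff φ) f = 0 := by
  rw [laplacian_zero_eq]
  refine ⟨fun h => ?_, fun h => by rw [h, mul_zero]⟩
  rw [← one_mul (divGrad _ _ _ _), ← Ring.mul_inverse_cancel _ (ρ.isUnit φ), mul_assoc, h, mul_zero]

theorem sgn_add (p q : ZMod 2) : sgn (p + q) = sgn p * sgn q := by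
  revert p q
  have h : ∀ p : ZMod 2, p = 0 ∨ p = 1 := by decide
  intro p q
  have e : (1 : ZMod 2) + 1 = 0 := rfl
  rcases h p with rfl | rfl <;> rcases h q with rfl | rfl <;> simp [sgn, e]

/-- Symmetry of the pairing `(f, g) ↦ ∂ₐg Sᵃᵇ ∂_b f` of even functions. -/
theorem pd_mul_comp_mul_pd (φ : M.Coords) {f g : M.Fun φ.dom} (hf : f ∈ M.part φ.dom 0)
    (hg : g ∈ M.part φ.dom 0) (a b : Idx n m) :
    φ.pd _ le_rfl a g * P.comp φ a b * φ.pd _ le_rfl b f =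
      φ.pd _ le_rfl b f * P.comp φ b a * φ.pd _ le_rfl a g := by
  have hx := φ.pd_mem_part le_rfl a hg
  have hz := φ.pd_mem_part le_rfl b hf
  have hy := P.comp_mem φ a b
  rw [M.supercomm _ (M.mul_mem _ hx hy) hz, M.supercomm _ hx hy, P.comp_symm φ a b]
  simp only [smul_mul_assoc, mul_smul_comm, smul_smul, ← sgn_add, mul_assoc]
  -- The exponent collects two reorderings and the symmetry of `S`, with `p = ã` and `q = b̃`. It
  -- vanishes because `S` is odd; for even components of parity `p + q` it would be `p + q`.
  have key : ∀ p q : ZMod 2,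
      (p + (p + q + 1)) * q + (p * (p + q + 1) + p * q) = 0 := by decide
  have h0 : sgn 0 = 1 := if_pos rfl
  rw [key, h0, one_smul]

/-! ### Composition, inverses and identities of solutions -/

variable {P}

theorem LaplacianExpEqZero.add {ρ ρ' : VolumeForm M} {σ τ : M.GlobalFun} (hσ : IsEven σ)
    (hτ : IsEven τ) (h : IsExpMul σ ρ ρ') (h₁ : LaplacianExpEqZero P ρ ((1 / 2 : ℝ) • σ))
    (h₂ : LaplacianExpEqZero P ρ' ((1 / 2 : ℝ) • τ)) :
    LaplacianExpEqZero P ρ ((1 / 2 : ℝ) • (σ + τ)) := fun φ => by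
  have hs : M.res (le_top : φ.dom ≤ ⊤) σ ∈ M.part φ.dom 0 := M.res_mem le_top hσ
  have ht : M.res (le_top : φ.dom ≤ ⊤) τ ∈ M.part φ.dom 0 := M.res_mem le_top hτ
  have hs' := Submodule.smul_mem _ (1 / 2 : ℝ) hs
  have hF := φ.exp_mem_part hs'
  have hG := φ.exp_mem_part (Submodule.smul_mem _ (1 / 2 : ℝ) ht)
  have e₁ := (laplacian_zero_eq_zero_iff P ρ φ _).1 (h₁ φ)
  have e₂ := (laplacian_zero_eq_zero_iff P ρ' φ _).1 (h₂ φ)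
  rw [map_smul] at e₁ e₂
  -- The coefficient of `ρ'` becomes `F * F * ρ` with `F = e^{σ/2}`.
  rw [h φ, ← φ.exp_half_mul_self hs] at e₂
  rw [laplacian_zero_eq_zero_iff, map_smul, map_add, smul_add, φ.exp_add hs']
  have key := divGrad_mul (D := fun a => (φ.pd _ le_rfl a).toAddMonoidHom)
    (fun a => φ.pd_mul le_rfl a hF) (fun a => φ.pd_mul le_rfl a hG)
    (Superspace.commute_of_even hF) (Superspace.commute_of_even hG)
    (Superspace.commute_of_even (ρ.coeff_even φ)) (pd_mul_comp_mul_pd P φ hF hG)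
  rw [e₁, e₂, mul_zero, zero_add] at key
  -- `key` now reads `F * L_ρ(FG) = 0`; multiplying by `e^{-σ/2}` removes `F`.
  have hinv := φ.exp_mul_exp_neg hs'
  rw [(Superspace.commute_of_even hF _).eq] at hinv
  rw [← one_mul (divGrad _ _ _ _), ← hinv, mul_assoc, key, mul_zero]

theorem LaplacianExpEqZero.neg {ρ ρ' : VolumeForm M} {σ : M.GlobalFun} (hσ : IsEven σ)
    (h : IsExpMul σ ρ ρ') (h₁ : LaplacianExpEqZero P ρ ((1 / 2 : ℝ) • σ)) :
    LaplacianExpEqZero P ρ' (-((1 / 2 : ℝ) • σ)) := fun φ => by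
  have hs : M.res (le_top : φ.dom ≤ ⊤) σ ∈ M.part φ.dom 0 := M.res_mem le_top hσ
  have hs' := Submodule.smul_mem _ (1 / 2 : ℝ) hs
  have hF := φ.exp_mem_part hs'
  have e₁ := (laplacian_zero_eq_zero_iff P ρ φ _).1 (h₁ φ)
  rw [map_smul] at e₁
  rw [laplacian_zero_eq_zero_iff, map_neg, map_smul, h φ, ← φ.exp_half_mul_self hs,
    divGrad_inverse (fun a => φ.pd_mul le_rfl a hF) (fun a => φ.pd_one le_rfl a)
      (Superspace.commute_of_even hF) (φ.exp_mul_exp_neg hs'), e₁, neg_zero]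

theorem LaplacianExpEqZero.zero (ρ : VolumeForm M) : LaplacianExpEqZero P ρ 0 := fun φ => by
  rw [laplacian_zero_eq_zero_iff, map_zero, φ.exp_zero, divGrad]
  refine Finset.sum_eq_zero fun a _ => ?_
  rw [Finset.sum_eq_zero fun b _ => ?_, mul_zero, map_zero]
  exact (congrArg _ (φ.pd_one le_rfl b)).trans (mul_zero _)

theorem IsExpMul.zero (ρ : VolumeForm M) : IsExpMul 0 ρ ρ := fun φ => by
  rw [map_zero, φ.exp_zero, one_mul]

theorem IsExpMul.add {ρ ρ' ρ'' : VolumeForm M} {σ τ : M.GlobalFun} (hσ : IsEven σ)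
    (h₁ : IsExpMul σ ρ ρ') (h₂ : IsExpMul τ ρ' ρ'') : IsExpMul (σ + τ) ρ ρ'' := fun φ => by
  have hs : M.res (le_top : φ.dom ≤ ⊤) σ ∈ M.part φ.dom 0 := M.res_mem le_top hσ
  rw [h₂ φ, h₁ φ, map_add, φ.exp_add hs,
    (Superspace.commute_of_even (φ.exp_mem_part hs) (φ.exp (M.res le_top τ))).eq, mul_assoc]

theorem IsExpMul.neg {ρ ρ' : VolumeForm M} {σ : M.GlobalFun} (hσ : IsEven σ)
    (h : IsExpMul σ ρ ρ') : IsExpMul (-σ) ρ' ρ := fun φ => by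
  have hs : M.res (le_top : φ.dom ≤ ⊤) σ ∈ M.part φ.dom 0 := M.res_mem le_top hσ
  have hinv := φ.exp_mul_exp_neg hs
  rw [(Superspace.commute_of_even (φ.exp_mem_part hs) _).eq] at hinv
  rw [h φ, map_neg, ← mul_assoc, hinv, one_mul]

variable (P)

/-- The master groupoid. -/
@[reducible]
def masterGroupoid : CategoryTheory.Groupoid.{u} (VolumeForm M) where
  Hom ρ ρ' := MasterArrow P ρ ρ'
  id ρ := ⟨0, zero_mem _, IsExpMul.zero ρ, by rw [smul_zero]; exact LaplacianExpEqZero.zero ρ⟩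
  comp α β := ⟨α.1 + β.1, add_mem α.2.1 β.2.1, α.2.2.1.add α.2.1 β.2.2.1,
    α.2.2.2.add α.2.1 β.2.1 α.2.2.1 β.2.2.2⟩
  inv α := ⟨-α.1, neg_mem α.2.1, α.2.2.1.neg α.2.1, by
    rw [smul_neg]; exact α.2.2.2.neg α.2.1 α.2.2.1⟩
  id_comp α := Subtype.ext (zero_add α.1)
  comp_id α := Subtype.ext (add_zero α.1)
  assoc α β γ := Subtype.ext (add_assoc α.1 β.1 γ.1)
  inv_comp α := Subtype.ext (neg_add_cancel α.1)
  comp_inv α := Subtype.ext (add_neg_cancel α.1)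

end

end OddPoisson

end

open OddPoisson CategoryTheory in
theorem mainTheorem4 {n m : ℕ} (M : Supermanifold.{u} n m) (P : OddPoissonStructure M) :
    (∃ (G : Groupoid.{u} (VolumeForm M))
      (e : ∀ ρ ρ' : VolumeForm M, (ρ ⟶ ρ') ≃ MasterArrow P ρ ρ'),
      (∀ ρ, (e ρ ρ (𝟙 ρ)).1 = 0) ∧
      (∀ ρ ρ' ρ'' (α : ρ ⟶ ρ') (β : ρ' ⟶ ρ''),
        (e ρ ρ'' (α ≫ β)).1 = (e ρ ρ' α).1 + (e ρ' ρ'' β).1) ∧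
      (∀ ρ ρ' (α : ρ ⟶ ρ'), (e ρ' ρ (Groupoid.inv α)).1 = -(e ρ ρ' α).1)) ∧
    (∀ (ρ ρ' ρ'' : VolumeForm M) (σ τ : M.GlobalFun), IsEven σ → IsEven τ →
      IsExpMul σ ρ ρ' → IsExpMul τ ρ' ρ'' →
      LaplacianExpEqZero P ρ ((1 / 2 : ℝ) • σ) → LaplacianExpEqZero P ρ' ((1 / 2 : ℝ) • τ) →
      LaplacianExpEqZero P ρ ((1 / 2 : ℝ) • (σ + τ))) ∧
    (∀ (ρ ρ' : VolumeForm M) (σ : M.GlobalFun), IsEven σ → IsExpMul σ ρ ρ' →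
      LaplacianExpEqZero P ρ ((1 / 2 : ℝ) • σ) →
      LaplacianExpEqZero P ρ' (-((1 / 2 : ℝ) • σ))) := by
  exact ⟨⟨masterGroupoid P, fun _ _ => Equiv.refl _, fun _ => rfl, fun _ _ _ _ _ => rfl,
      fun _ _ _ => rfl⟩,
    fun _ _ _ _ _ hσ hτ h _ h₁ h₂ => h₁.add hσ hτ h h₂, fun _ _ _ hσ h h₁ => h₁.neg hσ h⟩
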